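/- Let $\mathcal H$ be a complex Hilbert space (inner product $\langle\cdot|\cdot\rangle$ antilinear in the first argument) with a complex conjugation $f\mapsto\bar f$ (an antiunitary involution); for example $L^2$ of a lattice or of $\mathbb R^\nu$ with pointwise conjugation. Let $\mathcal A(a)$ be the CAR algebra over $\mathcal H$, i.e. the unital C*-algebra generated by elements $a(f)$, antilinear in $f\in\mathcal H$, with $[a(f),a(g)]_+=0$ and $[a(f),a^*(g)]_+=\langle f|g\rangle$, and let $\tau$ be the tracial state on $\mathcal A(a)$, with GNS representation $\pi$ on the Hilbert space $\mathcal K$ and GNS vector $\Omega$; write $a(f)$ also for $\pi(a(f))$ and $\mathcal A(a)'=\pi(\mathcal A(a))'$. Let $J$ be the modular conjugation of the von Neumann algebra $\mathcal A(a)''$ with respect to $\Omega$. Then there are bounded operators $A(f),B(f)$ on $\mathcal K$, antilinear in $f\in\mathcal H$, such that the following hold. 1. $(\mathcal K,A,B,\Omega)$ is the Fock vacuum representation of the doubled CAR algebra: $A$ and $B$ each satisfy the CAR, $[A(f),B(g)]_+=[A(f),B^*(g)]_+=0$, $A(f)\Omega=B(f)\Omega=0$, $\|\Omega\|=1$, and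 $\Omega$ is cyclic for the *-algebra generated by the $A(f),B(f)$. The vacuum state restricted to $\mathcal A(a)$ is $\tau$, that is, $\langle\Omega|\pi(x)\Omega\rangle=\tau(x)$ for $x\in\mathcal A(a)$. For every representation $(\mathcal K_1,A_1,B_1,\Omega_1)$ with these properties of the doubled CAR algebra there is a unitary $U:\mathcal K\to\mathcal K_1$ with $U\Omega=\Omega_1$, $UA(f)=A_1(f)U$, $UB(f)=B_1(f)U$. 2. The two algebras are connected by the Bogoliubov transformation $$a(f)=\tfrac1{\sqrt2}\bigl(A(f)+B^*(\bar f)\bigr).$$ 3. Let $H_e$ and $H_o$ be the closed subspaces of $\mathcal K$ built from $\Omega$ by even, respectively odd, polynomials in $A,B,A^*,B^*$, and let $W$ be the bounded operator with $W\psi=\psi$ for $\psi\in H_e$ and $W\psi=-\psi$ for $\psi\in H_o$. Then $$b(f):=WJa(f)^*J=\tfrac1{\sqrt2}\bigl(A(f)-B^*(\bar f)\bigr),\qquad WJa(\bar f)J=-b^*(\bar f).$$ 4. The $b$'s satisfy the CAR, $[b(f),b(g)]_+=0$ and $[b(f),b^*(g)]_+=\langle f|g\rangle$, and anticommute with the $a$'s: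 $[a(f),b(g)]_+=0=[a(f),b^*(g)]_+$. The even algebra $\mathcal A(b)_e$ (the norm closure of the even polynomials in the $b(f),b^*(g)$) commutes with $\mathcal A(a)$. 5. The operators $Wb(f)$ and $b^*(g)W$ commute with $\mathcal A(a)$, and they generate the commutant $\mathcal A(a)'$ as a von Neumann algebra: $\{Wb(f),\,b^*(g)W : f,g\in\mathcal H\}''=\mathcal A(a)'$. -/

import Mathlib

open scoped InnerProductSpace ComplexOrder

noncomputable section

namespace TracialFermi

section Car

variable {H R : Type*} [NormedAddCommGroup H] [InnerProductSpace ℂ H]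
  [Ring R] [StarRing R] [Algebra ℂ R]

/-- Annihilation operators `a(f)`, antilinear in `f`, satisfying the canonical anticommutation
relations `[a(f), a(g)]₊ = 0` and `[a(f), a*(g)]₊ = ⟨f|g⟩`. -/
structure IsCAR (a : H →ₗ⋆[ℂ] R) : Prop where
  anti : ∀ f g, a f * a g + a g * a f = 0
  car : ∀ f g, a f * star (a g) + star (a g) * a f = algebraMap ℂ R ⟪f, g⟫_ℂ

/-- Two families of annihilation operators which both satisfy the canonical anticommutation
relations and which anticommute with each other. -/
structure IsDoubleCAR (A B : H →ₗ⋆[ℂ] R) : Prop where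
  left : IsCAR A
  right : IsCAR B
  anti : ∀ f g, A f * B g + B g * A f = 0
  anti_star : ∀ f g, A f * star (B g) + star (B g) * A f = 0

/-- The annihilation operators `a(f)` together with the creation operators `a*(f)`. -/
def generators (a : H →ₗ⋆[ℂ] R) : Set R :=
  Set.range (fun f => a f) ∪ Set.range (fun f => star (a f))

/-- Even polynomials: linear combinations of products of an even number of elements of `S`. -/
def evenPolynomials (S : Set R) : Submodule ℂ R :=
  Submodule.span ℂ {x | ∃ l : List R, (∀ y ∈ l, y ∈ S) ∧ Even l.length ∧ x = l.prod}

/-- Odd polynomials: linear combinations of products of an odd number of elements of `S`. -/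
def oddPolynomials (S : Set R) : Submodule ℂ R :=
  Submodule.span ℂ {x | ∃ l : List R, (∀ y ∈ l, y ∈ S) ∧ Odd l.length ∧ x = l.prod}

end Car

/-- The C*-algebra `𝒜` is the CAR algebra over `H` with annihilation operators `a(f)`. -/
structure IsCARAlgebra {H 𝒜 : Type*} [NormedAddCommGroup H] [InnerProductSpace ℂ H]
    [CStarAlgebra 𝒜] (a : H →ₗ⋆[ℂ] 𝒜) : Prop where
  isCAR : IsCAR a
  dense : Dense (StarAlgebra.adjoin ℂ (Set.range (fun f => a f)) : Set 𝒜)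

/-- A tracial state. -/
structure IsTracialState {𝒜 : Type*} [CStarAlgebra 𝒜] [PartialOrder 𝒜]
    (τ : 𝒜 →ₚ[ℂ] ℂ) : Prop where
  map_one : τ 1 = 1
  trace : ∀ x y, τ (x * y) = τ (y * x)

section Operators

variable {H F : Type*} [NormedAddCommGroup H] [InnerProductSpace ℂ H]
  [NormedAddCommGroup F] [InnerProductSpace ℂ F] [CompleteSpace F]

/-- The Fock vacuum representation of the doubled CAR algebra: operators `A(f)`, `B(f)` on a
Hilbert space satisfying the relations, and a unit vector `Ω` which is annihilated by all of them
and is cyclic for the algebra they generate. -/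
structure IsVacuumRepresentation (A B : H →ₗ⋆[ℂ] (F →L[ℂ] F)) (Ω : F) : Prop where
  isDoubleCAR : IsDoubleCAR A B
  norm_vacuum : ‖Ω‖ = 1
  annihilate_left : ∀ f, A f Ω = 0
  annihilate_right : ∀ f, B f Ω = 0
  cyclic : Dense ((fun x : F →L[ℂ] F => x Ω) ''
    (StarAlgebra.adjoin ℂ (Set.range (fun f => A f) ∪ Set.range (fun f => B f)) :
      Set (F →L[ℂ] F)))

/-- `J` is the modular conjugation of the von Neumann algebra `M` with cyclic and separating
vector `Ω`: an antiunitary involution such that the closure `S` of `x Ω ↦ x* Ω`, `x ∈ M`, has the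
polar decomposition `S = J T` with `T` (the square root of the modular operator) positive and
self-adjoint. As `J² = 1`, the latter says that `T` is the closure of `x Ω ↦ J x* Ω`. -/
structure IsModularConjugation (M : Set (F →L[ℂ] F)) (Ω : F) (J : F ≃ₗᵢ⋆[ℂ] F) : Prop where
  involutive : ∀ ψ, J (J ψ) = ψ
  polar : ∃ T : F →ₗ.[ℂ] F, Dense (T.domain : Set F) ∧ IsSelfAdjoint T ∧
    (∀ ψ : T.domain, 0 ≤ ⟪(ψ : F), T ψ⟫_ℂ) ∧
    (T.graph : Set (F × F)) = closure {p | ∃ x ∈ M, p = (x Ω, J (star x Ω))}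

/-- The closed subspace of vectors built from `Ω` by even polynomials in elements of `S`. -/
def evenSubspace (S : Set (F →L[ℂ] F)) (Ω : F) : Submodule ℂ F :=
  ((evenPolynomials S).map (ContinuousLinearMap.apply ℂ F Ω).toLinearMap).topologicalClosure

/-- The closed subspace of vectors built from `Ω` by odd polynomials in elements of `S`. -/
def oddSubspace (S : Set (F →L[ℂ] F)) (Ω : F) : Submodule ℂ F :=
  ((oddPolynomials S).map (ContinuousLinearMap.apply ℂ F Ω).toLinearMap).topologicalClosure

end Operators

section Gns

variable {H 𝒜 : Type*} [NormedAddCommGroup H] [InnerProductSpace ℂ H]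
  [CStarAlgebra 𝒜] [PartialOrder 𝒜] [StarOrderedRing 𝒜]

/-- The GNS vector of `τ`: the class of the unit. -/
def gnsVector (τ : 𝒜 →ₚ[ℂ] ℂ) : τ.GNS := ((τ.toPreGNS 1 : τ.PreGNS) : τ.GNS)

/-- The annihilation operators `a(f)` in the GNS representation of `τ`. -/
def gnsField (τ : 𝒜 →ₚ[ℂ] ℂ) (a : H →ₗ⋆[ℂ] 𝒜) : H →ₗ⋆[ℂ] (τ.GNS →L[ℂ] τ.GNS) :=
  (τ.gnsStarAlgHom : 𝒜 →ₗ[ℂ] (τ.GNS →L[ℂ] τ.GNS)).comp a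

end Gns

end TracialFermi

end

/-!
In the GNS representation `π` of the trace `τ`, the map `π(x)Ω ↦ π(x*)Ω` is isometric because `τ` is
a trace, and it extends to an antiunitary involution `J`; `J π(x)* J` is right multiplication by `x`.
For `T` in `π(𝒜)''` or in `π(𝒜)'` one has `J T Ω = T* Ω`
(`IsTracialConjugation.map_commutant_right`, `IsTracialConjugation.map_commutant`). For the former
this says that `J` is the modular conjugation, with trivial modular operator, and both together give
the commutation theorem: the right multiplications generate `π(𝒜)'`
(`IsTracialConjugation.commutation_theorem`).

The parity automorphism of the CAR algebra of a finite-dimensional space is inner, so `τ` vanishes on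
odd words in the fields (`IsCAR.trace_odd`). Hence even and odd words yield orthogonal vectors, and
there is a self-adjoint unitary `W` which is `1` on the former and `-1` on the latter
(`IsCARAlgebra.exists_parityOperator`). It anticommutes with left and right multiplication by fields.
Left and right multiplications commute, so the twisted right fields `b(f) = W J a(f)* J` satisfy the
CAR, anticommute with the `a(f)`, and `W b(f)`, `b*(f) W` are right multiplications by the fields,
which generate all right multiplications (`isDoubleCAR_twistedField`, `centralizer_twistedField`).

Since `b(f)Ω = -a(f)Ω` and `b*(f)Ω = a*(f)Ω`, the vector `Ω` is annihilated by
`A(f) = (a(f) + b(f)) / √2` and `B(f) = (a*(f̄) - b*(f̄)) / √2`, which satisfy the doubled CAR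
because the Bogoliubov transformation preserves them (`isVacuumRepresentation_bogoliubov`).
Finally, moving annihilation operators to the right expresses the vacuum expectation of a word through
those of shorter words, so that all inner products of words applied to the vacuum are determined by
the relations; this gives the unitary equivalence of vacuum representations
(`IsVacuumRepresentation.exists_unitary`).
-/

noncomputable section

open scoped CStarAlgebra

namespace TracialFermi

/-! ### Antiunitary involutions -/

section Antiunitary

variable {E F : Type*} [NormedAddCommGroup E] [InnerProductSpace ℂ E]
  [NormedAddCommGroup F] [InnerProductSpace ℂ F]

/-- Polarization: an antilinear isometry conjugates inner products. -/
theorem inner_map_map_conj (J : E ≃ₗᵢ⋆[ℂ] F) (x y : E) : ⟪J x, J y⟫_ℂ = ⟪y, x⟫_ℂ := by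
  have hI : ∀ z, J (Complex.I • z) = -(Complex.I • J z) := fun z => by
    rw [LinearIsometryEquiv.map_smulₛₗ]; simp
  rw [← inner_conj_symm y x, inner_eq_sum_norm_sq_div_four, inner_eq_sum_norm_sq_div_four x y]
  have h1 : ‖J x + J y‖ = ‖x + y‖ := by rw [← map_add, J.norm_map]
  have h2 : ‖J x - J y‖ = ‖x - y‖ := by rw [← map_sub, J.norm_map]
  have h3 : ‖J x - Complex.I • J y‖ = ‖x + Complex.I • y‖ := by
    rw [← J.norm_map, map_add, hI, sub_eq_add_neg]
  have h4 : ‖J x + Complex.I • J y‖ = ‖x - Complex.I • y‖ := by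
    rw [← J.norm_map, map_sub, hI, sub_neg_eq_add]
  simp only [RCLike.I_to_complex] at *
  rw [h1, h2, h3, h4]
  simp only [RCLike.ofReal_eq_complex_ofReal, map_div₀, map_add, map_mul, map_sub, map_pow,
    Complex.conj_ofReal, Complex.conj_I, Complex.conj_ofNat]
  ring

variable {J : E ≃ₗᵢ⋆[ℂ] E}

theorem inner_conj_left (hJ : ∀ ψ, J (J ψ) = ψ) (x y : E) : ⟪J x, y⟫_ℂ = ⟪J y, x⟫_ℂ := by
  rw [← inner_map_map_conj J, hJ]

theorem inner_conj_right (hJ : ∀ ψ, J (J ψ) = ψ) (x y : E) : ⟪x, J y⟫_ℂ = ⟪y, J x⟫_ℂ := by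
  rw [← inner_map_map_conj J, hJ]

variable (J) in
/-- The linear operator `J T J`, for an antiunitary `J`. -/
def conjugate (T : E →L[ℂ] E) : E →L[ℂ] E :=
  (J.toContinuousLinearEquiv : E →L⋆[ℂ] E).comp
    (T.comp (J.toContinuousLinearEquiv : E →L⋆[ℂ] E))

@[simp]
theorem conjugate_apply (T : E →L[ℂ] E) (ψ : E) : conjugate J T ψ = J (T (J ψ)) := rfl

theorem conjugate_add (S T : E →L[ℂ] E) :
    conjugate J (S + T) = conjugate J S + conjugate J T := by
  ext; simp

theorem conjugate_smul (c : ℂ) (T : E →L[ℂ] E) :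
    conjugate J (c • T) = starRingEnd ℂ c • conjugate J T := by
  ext; simp [LinearIsometryEquiv.map_smulₛₗ]

theorem conjugate_one (hJ : ∀ ψ, J (J ψ) = ψ) : conjugate J (1 : E →L[ℂ] E) = 1 := by
  ext; simp [hJ]

theorem conjugate_mul (hJ : ∀ ψ, J (J ψ) = ψ) (S T : E →L[ℂ] E) :
    conjugate J (S * T) = conjugate J S * conjugate J T := by
  ext; simp [hJ]

theorem conjugate_conjugate (hJ : ∀ ψ, J (J ψ) = ψ) (T : E →L[ℂ] E) :
    conjugate J (conjugate J T) = T := by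
  ext; simp [hJ]

theorem star_conjugate [CompleteSpace E] (hJ : ∀ ψ, J (J ψ) = ψ) (T : E →L[ℂ] E) :
    star (conjugate J T) = conjugate J (star T) := by
  refine ((ContinuousLinearMap.eq_adjoint_iff _ _).2 fun x y => ?_).symm
  simp only [conjugate_apply, ContinuousLinearMap.star_eq_adjoint]
  rw [inner_conj_left hJ, ContinuousLinearMap.adjoint_inner_right, inner_conj_right hJ]

end Antiunitary

/-! ### Tracial vectors and the commutation theorem -/

section StandardForm

variable {𝒜 K : Type*} [CStarAlgebra 𝒜] [NormedAddCommGroup K] [InnerProductSpace ℂ K]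
  [CompleteSpace K]

/-- The unit vector `Ω` is cyclic for the representation `π` and its vector state is a trace. -/
structure IsTracialVector (π : 𝒜 →⋆ₐ[ℂ] (K →L[ℂ] K)) (Ω : K) : Prop where
  norm_eq_one : ‖Ω‖ = 1
  cyclic : DenseRange fun x => π x Ω
  trace : ∀ x y, ⟪Ω, π (x * y) Ω⟫_ℂ = ⟪Ω, π (y * x) Ω⟫_ℂ

/-- `J` is the antiunitary extension of `x Ω ↦ x* Ω`. -/
def IsTracialConjugation (π : 𝒜 →⋆ₐ[ℂ] (K →L[ℂ] K)) (Ω : K) (J : K ≃ₗᵢ⋆[ℂ] K) : Prop :=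
  ∀ x, J (π x Ω) = π (star x) Ω

variable {π : 𝒜 →⋆ₐ[ℂ] (K →L[ℂ] K)} {Ω : K} {J : K ≃ₗᵢ⋆[ℂ] K}

theorem inner_star_apply (T : K →L[ℂ] K) (φ ψ : K) : ⟪star T φ, ψ⟫_ℂ = ⟪φ, T ψ⟫_ℂ :=
  ContinuousLinearMap.adjoint_inner_left T ψ φ

theorem inner_apply_star (T : K →L[ℂ] K) (φ ψ : K) : ⟪φ, star T ψ⟫_ℂ = ⟪T φ, ψ⟫_ℂ :=
  ContinuousLinearMap.adjoint_inner_right T φ ψ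

theorem inner_representation (x y : 𝒜) : ⟪π x Ω, π y Ω⟫_ℂ = ⟪Ω, π (star x * y) Ω⟫_ℂ := by
  rw [← inner_apply_star, ← map_star, map_mul]; rfl

/-- By the trace property, `x Ω ↦ x* Ω` is isometric on a dense subspace. -/
theorem IsTracialVector.exists_conjugation (h : IsTracialVector π Ω) :
    ∃ J : K ≃ₗᵢ⋆[ℂ] K, IsTracialConjugation π Ω J := by
  let e : 𝒜 →ₗ[ℂ] K :=
    (ContinuousLinearMap.apply ℂ K Ω).toLinearMap ∘ₗ (π : 𝒜 →ₗ[ℂ] (K →L[ℂ] K))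
  have he : DenseRange e := h.cyclic
  have hn : ∀ x, ‖e (starLinearEquiv ℂ x)‖ = ‖e x‖ := fun x => by
    have h2 : ⟪π (star x) Ω, π (star x) Ω⟫_ℂ = ⟪π x Ω, π x Ω⟫_ℂ := by
      rw [inner_representation, inner_representation, star_star, h.trace]
    rw [inner_self_eq_norm_sq_to_K, inner_self_eq_norm_sq_to_K] at h2
    change ‖π (star x) Ω‖ = ‖π x Ω‖
    exact (pow_left_inj₀ (norm_nonneg _) (norm_nonneg _) two_ne_zero).1 (by exact_mod_cast h2)
  exact ⟨(starLinearEquiv ℂ : 𝒜 ≃ₗ⋆[ℂ] 𝒜).extendOfIsometry e e he he hn, fun x =>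
    LinearEquiv.extendOfIsometry_eq (starLinearEquiv ℂ : 𝒜 ≃ₗ⋆[ℂ] 𝒜) e e he he hn x⟩

theorem IsTracialVector.clm_ext (h : IsTracialVector π Ω) {S T : K →L[ℂ] K}
    (hST : ∀ x, S (π x Ω) = T (π x Ω)) : S = T := by
  ext ψ
  exact congr_fun (h.cyclic.equalizer S.continuous T.continuous (funext hST)) ψ

theorem IsTracialVector.inner_ext (h : IsTracialVector π Ω) {φ ψ : K}
    (hφ : ∀ x, ⟪π x Ω, φ⟫_ℂ = ⟪π x Ω, ψ⟫_ℂ) : φ = ψ := by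
  refine ext_inner_left ℂ fun v => ?_
  exact congr_fun (h.cyclic.equalizer (g := fun v => ⟪v, φ⟫_ℂ) (h := fun v => ⟪v, ψ⟫_ℂ)
    (by fun_prop) (by fun_prop) (funext hφ)) v

theorem IsTracialConjugation.involutive (hJ : IsTracialConjugation π Ω J)
    (h : IsTracialVector π Ω) (ψ : K) : J (J ψ) = ψ :=
  congr_fun (h.cyclic.equalizer (g := fun v => J (J v)) (h := id)
    (J.continuous.comp J.continuous) continuous_id (funext fun x => by simp [hJ x, hJ (star x)])) ψ

theorem IsTracialConjugation.map_vector (hJ : IsTracialConjugation π Ω J) : J Ω = Ω := by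
  simpa using hJ 1

/-- `J x* J` is right multiplication by `x`. -/
theorem IsTracialConjugation.conjugate_star_apply (hJ : IsTracialConjugation π Ω J) (x y : 𝒜) :
    conjugate J (π (star x)) (π y Ω) = π (y * x) Ω := by
  rw [conjugate_apply, hJ]
  have := hJ (star x * star y)
  simpa using this

/-- Left and right multiplications commute. -/
theorem IsTracialConjugation.commute (hJ : IsTracialConjugation π Ω J)
    (h : IsTracialVector π Ω) (x y : 𝒜) : Commute (conjugate J (π x)) (π y) := by
  refine h.clm_ext fun z => ?_
  rw [← star_star x]
  have hy : ∀ v, π y (π v Ω) = π (y * v) Ω := fun v => by rw [map_mul]; rfl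
  change conjugate J _ (π y (π z Ω)) = π y (conjugate J _ (π z Ω))
  rw [hJ.conjugate_star_apply, hy, hy, hJ.conjugate_star_apply, mul_assoc]

theorem IsTracialConjugation.conjugate_vector (hJ : IsTracialConjugation π Ω J) (x : 𝒜) :
    conjugate J (π x) Ω = π (star x) Ω := by
  rw [conjugate_apply, hJ.map_vector, hJ]

/-- The conjugation implements the adjoint on the commutant as well. -/
theorem IsTracialConjugation.map_commutant (hJ : IsTracialConjugation π Ω J)
    (h : IsTracialVector π Ω) {T : K →L[ℂ] K} (hT : T ∈ Set.centralizer (Set.range π)) :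
    J (T Ω) = star T Ω := by
  refine h.inner_ext fun y => ?_
  have hy : T (π y Ω) = π y (T Ω) := (DFunLike.congr_fun (hT _ ⟨y, rfl⟩) Ω).symm
  rw [inner_apply_star, hy, inner_conj_right (hJ.involutive h), hJ, map_star, inner_apply_star,
    ← inner_conj_symm]

theorem IsTracialConjugation.conjugate_mem_commutant (hJ : IsTracialConjugation π Ω J)
    (h : IsTracialVector π Ω) {T : K →L[ℂ] K}
    (hT : T ∈ Set.centralizer (Set.range fun x => conjugate J (π x))) :
    conjugate J T ∈ Set.centralizer (Set.range π) := by
  rintro _ ⟨x, rfl⟩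
  have := congr_arg (conjugate J) (hT _ ⟨x, rfl⟩)
  simpa only [conjugate_mul (hJ.involutive h), conjugate_conjugate (hJ.involutive h)] using this

/-- The conjugation implements the adjoint on the commutant of the right multiplications, and in
particular on the von Neumann algebra generated by the representation. -/
theorem IsTracialConjugation.map_commutant_right (hJ : IsTracialConjugation π Ω J)
    (h : IsTracialVector π Ω) {T : K →L[ℂ] K}
    (hT : T ∈ Set.centralizer (Set.range fun x => conjugate J (π x))) :
    J (T Ω) = star T Ω := by
  have := hJ.map_commutant h (hJ.conjugate_mem_commutant h hT)
  rw [star_conjugate (hJ.involutive h)] at this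
  simp only [conjugate_apply, hJ.map_vector] at this
  exact J.injective this

theorem IsTracialConjugation.centralizer_centralizer_subset (hJ : IsTracialConjugation π Ω J)
    (h : IsTracialVector π Ω) :
    Set.centralizer (Set.centralizer (Set.range π)) ⊆
      Set.centralizer (Set.range fun x => conjugate J (π x)) := by
  refine Set.centralizer_subset ?_
  rintro _ ⟨x, rfl⟩ _ ⟨y, rfl⟩
  exact (hJ.commute h x y).symm

/-- **Commutation theorem** for a trace: the right multiplications generate the commutant of the
left multiplications. -/
theorem IsTracialConjugation.commutation_theorem (hJ : IsTracialConjugation π Ω J)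
    (h : IsTracialVector π Ω) :
    Set.centralizer (Set.centralizer (Set.range fun x => conjugate J (π x))) =
      Set.centralizer (Set.range π) := by
  apply Set.Subset.antisymm
  · refine Set.centralizer_subset ?_
    rintro _ ⟨x, rfl⟩ _ ⟨y, rfl⟩
    exact hJ.commute h y x
  have hJ2 := hJ.involutive h
  -- It remains to see that `X ∈ π(𝒜)'` commutes with each `Y` in the commutant of the right
  -- multiplications; this is checked on matrix elements between `π z Ω` and `π w Ω`.
  have L : ∀ T ∈ Set.centralizer (Set.range π), ∀ z ψ, T (π z ψ) = π z (T ψ) :=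
    fun T hT z ψ => (DFunLike.congr_fun (hT _ ⟨z, rfl⟩) ψ).symm
  have R : ∀ T ∈ Set.centralizer (Set.range fun x => conjugate J (π x)), ∀ z ψ,
      T (conjugate J (π z) ψ) = conjugate J (π z) (T ψ) :=
    fun T hT z ψ => (DFunLike.congr_fun (hT _ ⟨z, rfl⟩) ψ).symm
  intro X hX Y hY
  have hXs : star X ∈ Set.centralizer (Set.range π) := by
    rintro _ ⟨z, rfl⟩
    have := congr_arg star (hX _ ⟨star z, rfl⟩)
    simpa only [star_mul, ← map_star, star_star] using this.symm
  have hYs : star Y ∈ Set.centralizer (Set.range fun x => conjugate J (π x)) := by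
    rintro _ ⟨z, rfl⟩
    have := congr_arg star (hY _ ⟨star z, rfl⟩)
    simpa only [star_mul, star_conjugate hJ2, ← map_star, star_star] using this.symm
  refine h.clm_ext fun w => h.inner_ext fun z => ?_
  -- `π z Ω` and `π w Ω` are written with a left or a right multiplication applied to `Ω`, whichever
  -- commutes with the operator that acts on it.
  have e1 : ⟪π z Ω, Y (X (π w Ω))⟫_ℂ =
      ⟪conjugate J (π (star z)) (star Y Ω), π w (X Ω)⟫_ℂ := by
    rw [← inner_star_apply, L X hX, ← R _ hYs, hJ.conjugate_vector, star_star]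
  have e2 : ⟪π z Ω, X (Y (π w Ω))⟫_ℂ =
      ⟪π z (star X Ω), conjugate J (π (star w)) (Y Ω)⟫_ℂ := by
    rw [← inner_star_apply, ← R Y hY, hJ.conjugate_vector, star_star, L _ hXs]
  change ⟪π z Ω, Y (X (π w Ω))⟫_ℂ = ⟪π z Ω, X (Y (π w Ω))⟫_ℂ
  -- With `X* Ω = J X Ω` and `Y* Ω = J Y Ω`, the two sides differ only in the order of a left and a
  -- right multiplication.
  rw [e1, e2, ← hJ.map_commutant h hX, ← hJ.map_commutant_right h hY, conjugate_apply, hJ2,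
    inner_conj_left hJ2, conjugate_apply, inner_conj_right hJ2, map_star, inner_apply_star,
    map_star, inner_star_apply, ← inner_map_map_conj J (Y Ω)]
  have := DFunLike.congr_fun (hJ.commute h z w) (X Ω)
  exact congr_arg (inner ℂ (J (Y Ω))) this

/-- For a trace the modular operator is the identity: `J x* Ω = x Ω`, so the closed graph which the
definition asks for is the diagonal. -/
theorem IsTracialConjugation.isModularConjugation (hJ : IsTracialConjugation π Ω J)
    (h : IsTracialVector π Ω) :
    IsModularConjugation (Set.centralizer (Set.centralizer (Set.range π))) Ω J := by
  have hJ2 := hJ.involutive h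
  refine ⟨hJ2, (ContinuousLinearMap.id ℂ K).toPMap ⊤, by simp, ?_, fun ψ => ?_, ?_⟩
  · rw [LinearPMap.isSelfAdjoint_def,
      ContinuousLinearMap.toPMap_adjoint_eq_adjoint_toPMap_of_dense _ (by simp)]
    rw [← ContinuousLinearMap.star_eq_adjoint]
    change (((star 1 : K →L[ℂ] K)) : K →ₗ[ℂ] K).toPMap ⊤ = _
    rw [star_one]
    rfl
  · change 0 ≤ ⟪(ψ : K), (ψ : K)⟫_ℂ
    rw [inner_self_eq_norm_sq_to_K]
    exact Complex.zero_le_real.2 (by positivity) |>.trans_eq (Complex.ofReal_pow _ _)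
  · have hM : ∀ x ∈ Set.centralizer (Set.centralizer (Set.range π)),
        J (star x Ω) = x Ω := fun x hx => by
      rw [← hJ.map_commutant_right h (hJ.centralizer_centralizer_subset h hx), hJ2]
    have hcl : IsClosed {p : K × K | p.1 = p.2} := isClosed_eq continuous_fst continuous_snd
    apply Set.Subset.antisymm
    · rintro ⟨ψ, φ⟩ hp
      obtain ⟨v, rfl, rfl⟩ := (LinearPMap.mem_graph_iff _).1 hp
      refine map_mem_closure (f := fun v : K => (v, v)) (by fun_prop) (h.cyclic v) ?_
      rintro _ ⟨x, rfl⟩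
      have hx : π x ∈ Set.centralizer (Set.centralizer (Set.range π)) :=
        Set.subset_centralizer_centralizer ⟨x, rfl⟩
      exact ⟨π x, hx, by rw [hM _ hx]⟩
    · intro p hp
      have : p.1 = p.2 := by
        refine closure_minimal ?_ hcl hp
        rintro _ ⟨x, hx, rfl⟩
        exact (hM x hx).symm
      exact (LinearPMap.mem_graph_iff _).2 ⟨⟨p.1, trivial⟩, rfl, this⟩

end StandardForm

/-! ### Words in the fields and their parity -/

section Parity

variable {H R : Type*} [NormedAddCommGroup H] [InnerProductSpace ℂ H]
  [Ring R] [StarRing R] [Algebra ℂ R]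

theorem mem_generators_left (a : H →ₗ⋆[ℂ] R) (f : H) : a f ∈ generators a := Or.inl ⟨f, rfl⟩

theorem mem_generators_right (a : H →ₗ⋆[ℂ] R) (f : H) : star (a f) ∈ generators a :=
  Or.inr ⟨f, rfl⟩

theorem star_mem_generators {a : H →ₗ⋆[ℂ] R} {x : R} (hx : x ∈ generators a) :
    star x ∈ generators a := by
  obtain ⟨f, rfl⟩ | ⟨f, rfl⟩ := hx
  · exact mem_generators_right a f
  · simpa using mem_generators_left a f

/-- An element which anticommutes with all letters (anti)commutes with a word according to its
length. -/
theorem mul_list_prod_of_anticommute {S : Type*} [Ring S] {u : S} {l : List S}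
    (h : ∀ y ∈ l, u * y = -(y * u)) : u * l.prod = (-1) ^ l.length * (l.prod * u) := by
  induction l with
  | nil => simp
  | cons y l ih =>
    rw [List.forall_mem_cons] at h
    rw [List.prod_cons, ← mul_assoc, h.1, neg_mul, mul_assoc, ih h.2, List.length_cons, pow_succ]
    obtain hn | hn := Nat.even_or_odd l.length
    · simp [hn.neg_one_pow, mul_assoc]
    · simp [hn.neg_one_pow, mul_assoc]

namespace IsCAR

variable {a : H →ₗ⋆[ℂ] R} (ha : IsCAR a)
include ha

theorem mul_self (f : H) : a f * a f = 0 := by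
  have h := ha.anti f f
  have h2 : (2 : ℂ) • (a f * a f) = 0 := by rwa [two_smul]
  exact (smul_eq_zero_iff_right two_ne_zero).1 h2

theorem star_mul_star (f g : H) : star (a f) * star (a g) = -(star (a g) * star (a f)) := by
  have h := congr_arg star (ha.anti g f)
  simp only [star_add, star_mul, star_zero] at h
  exact eq_neg_of_add_eq_zero_left h

theorem mul_eq_neg (f g : H) : a f * a g = -(a g * a f) := eq_neg_of_add_eq_zero_left (ha.anti f g)

theorem mul_star_eq_neg {f g : H} (h : ⟪f, g⟫_ℂ = 0) : a f * star (a g) = -(star (a g) * a f) := by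
  have := ha.car f g
  rw [h, map_zero] at this
  exact eq_neg_of_add_eq_zero_left this

/-- On the span of a finite orthonormal family, the parity automorphism of the CAR algebra is inner:
it is implemented by `u = ∏ (1 - 2 a*(eᵢ) a(eᵢ))`. -/
theorem exists_parity_of_orthonormal {ι : Type*} {e : ι → H} (he : Orthonormal ℂ e)
    (s : Finset ι) :
    ∃ u : R, u * u = 1 ∧
      (∀ i ∈ s, SemiconjBy u (a (e i)) (-a (e i)) ∧
        SemiconjBy u (star (a (e i))) (-star (a (e i)))) ∧
      ∀ f, (∀ i ∈ s, ⟪f, e i⟫_ℂ = 0) → Commute u (a f) ∧ Commute u (star (a f)) := by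
  classical
  induction s using Finset.induction_on with
  | empty => exact ⟨1, by simp⟩
  | insert j s hj ih =>
    obtain ⟨u, hu, hs, hc⟩ := ih
    have hpp := ha.mul_self (e j)
    have hqq : star (a (e j)) * star (a (e j)) = 0 := by rw [← star_mul, hpp, star_zero]
    have hpq : a (e j) * star (a (e j)) + star (a (e j)) * a (e j) = 1 := by
      rw [ha.car, inner_self_eq_norm_sq_to_K, he.1 j]; simp
    have huj := hc (e j) fun i hi => he.2 fun h => hj (h ▸ hi)
    have hv : ∀ f, ⟪f, e j⟫_ℂ = 0 →
        Commute (1 - 2 * (star (a (e j)) * a (e j))) (a f) ∧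
        Commute (1 - 2 * (star (a (e j)) * a (e j))) (star (a f)) := by
      intro f hf
      have hf' : ⟪e j, f⟫_ℂ = 0 := inner_eq_zero_symm.1 hf
      have key : ∀ x, SemiconjBy x (a (e j)) (-a (e j)) →
          SemiconjBy x (star (a (e j))) (-star (a (e j))) →
          Commute (1 - 2 * (star (a (e j)) * a (e j))) x := by
        intro x h1 h2
        have h3 : Commute x (star (a (e j)) * a (e j)) := by
          have := h2.mul_right h1
          rwa [neg_mul_neg] at this
        exact ((Commute.one_right x).sub_right ((Commute.ofNat_right x 2).mul_right h3)).symm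
      refine ⟨key _ ?_ ?_, key _ ?_ ?_⟩
      · exact (ha.mul_eq_neg _ _).trans (neg_mul _ _).symm
      · exact (ha.mul_star_eq_neg hf).trans (neg_mul _ _).symm
      · exact (eq_neg_iff_add_eq_zero.2 (by
          rw [add_comm, ← eq_neg_iff_add_eq_zero]; exact ha.mul_star_eq_neg hf')).trans
          (neg_mul _ _).symm
      · exact (ha.star_mul_star _ _).trans (neg_mul _ _).symm
    -- By `p² = q² = 0` and `pq + qp = 1` alone, `1 - 2qp` is an involution which anticommutes with `p`
    -- and `q`.
    generalize hp : a (e j) = p at *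
    generalize hq : star p = q at *
    have hpqp : p * (q * p) = p := by
      rw [← mul_assoc, eq_sub_of_add_eq hpq, sub_mul, mul_assoc, hpp]; simp
    have hqpq : q * p * q = q := by
      rw [mul_assoc, eq_sub_of_add_eq hpq, mul_sub, ← mul_assoc, hqq]; simp
    have hvp : SemiconjBy (1 - 2 * (q * p)) p (-p) := by
      have h1 : (1 - 2 * (q * p)) * p = p := by
        rw [sub_mul, mul_assoc, mul_assoc, hpp]; simp
      have h2 : -p * (1 - 2 * (q * p)) = p := by
        have : p * (2 * (q * p)) = 2 * (p * (q * p)) := by noncomm_ring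
        rw [neg_mul, mul_sub, this, hpqp]; noncomm_ring
      exact h1.trans h2.symm
    have hvq : SemiconjBy (1 - 2 * (q * p)) q (-q) := by
      have h1 : (1 - 2 * (q * p)) * q = -q := by
        rw [sub_mul, mul_assoc, hqpq]; noncomm_ring
      have h2 : -q * (1 - 2 * (q * p)) = -q := by
        have : q * (2 * (q * p)) = 2 * (q * q * p) := by noncomm_ring
        rw [neg_mul, mul_sub, this, hqq]; simp
      exact h1.trans h2.symm
    have huv : Commute u (1 - 2 * (q * p)) :=
      (Commute.one_right u).sub_right
        ((Commute.ofNat_right u 2).mul_right (huj.2.mul_right huj.1))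
    have hvv : (1 - 2 * (q * p)) * (1 - 2 * (q * p)) = 1 := by
      have : (1 - 2 * (q * p)) * (1 - 2 * (q * p)) =
          1 - 4 * (q * p) + 4 * (q * (p * (q * p))) := by noncomm_ring
      rw [this, hpqp]; simp
    refine ⟨u * (1 - 2 * (q * p)), ?_, fun i hi => ?_, fun f hf => ?_⟩
    · rw [mul_assoc, ← mul_assoc _ u, ← huv.eq, mul_assoc, hvv, mul_one, hu]
    · obtain rfl | hi := Finset.mem_insert.1 hi
      · rw [hp, hq]
        exact ⟨SemiconjBy.mul_left huj.1.neg_right hvp, SemiconjBy.mul_left huj.2.neg_right hvq⟩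
      · obtain ⟨h1, h2⟩ := hv (e i) (he.2 fun h => hj (h ▸ hi))
        exact ⟨SemiconjBy.mul_left (hs i hi).1 h1, SemiconjBy.mul_left (hs i hi).2 h2⟩
    · obtain ⟨h1, h2⟩ := hv f (hf j (Finset.mem_insert_self _ _))
      obtain ⟨h3, h4⟩ := hc f fun i hi => hf i (Finset.mem_insert_of_mem hi)
      exact ⟨h3.mul_left h1, h4.mul_left h2⟩

/-- The parity automorphism is inner on the CAR algebra of a finite-dimensional subspace. -/
theorem exists_parity [StarModule ℂ R] (V : Submodule ℂ H) [FiniteDimensional ℂ V] :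
    ∃ u : R, u * u = 1 ∧ ∀ f ∈ V, u * a f = -(a f * u) ∧
      u * star (a f) = -(star (a f) * u) := by
  let e := stdOrthonormalBasis ℂ V
  have he : Orthonormal ℂ fun i => (e i : H) := e.orthonormal.comp_linearIsometry V.subtypeₗᵢ
  obtain ⟨u, hu, hs, -⟩ := ha.exists_parity_of_orthonormal he Finset.univ
  refine ⟨u, hu, fun f hf => ?_⟩
  have hsum : f = ∑ i, ⟪e i, ⟨f, hf⟩⟫_ℂ • (e i : H) := by
    have := congr_arg (V.subtype) (e.sum_repr' ⟨f, hf⟩)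
    simpa [map_sum] using this.symm
  constructor
  · rw [hsum]
    simp only [map_sum, LinearMap.map_smulₛₗ, Finset.mul_sum, Finset.sum_mul, mul_smul_comm,
      smul_mul_assoc, ← Finset.sum_neg_distrib, ← smul_neg]
    exact Finset.sum_congr rfl fun i _ => by
      rw [(hs i (Finset.mem_univ i)).1.eq, neg_mul]
  · rw [hsum]
    simp only [map_sum, LinearMap.map_smulₛₗ, star_sum, star_smul, Finset.mul_sum,
      Finset.sum_mul, mul_smul_comm, smul_mul_assoc, ← Finset.sum_neg_distrib, ← smul_neg]
    exact Finset.sum_congr rfl fun i _ => by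
      rw [(hs i (Finset.mem_univ i)).2.eq, neg_mul]

/-- A tracial functional vanishes on words of odd length in the fields: such a word `x` satisfies
`u x u = -x` for an involution `u`, whereas `τ (u x u) = τ x`. -/
theorem trace_odd [StarModule ℂ R] {τ : R →ₗ[ℂ] ℂ} (hτ : ∀ x y, τ (x * y) = τ (y * x))
    {l : List R} (hl : ∀ y ∈ l, y ∈ generators a) (hodd : Odd l.length) : τ l.prod = 0 := by
  have hV : ∃ V : Submodule ℂ H, FiniteDimensional ℂ V ∧
      ∀ y ∈ l, ∃ f ∈ V, y = a f ∨ y = star (a f) := by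
    clear hodd
    induction l with
    | nil => exact ⟨⊥, inferInstance, by simp⟩
    | cons y l ih =>
      rw [List.forall_mem_cons] at hl
      obtain ⟨V, hV, h⟩ := ih hl.2
      obtain ⟨f, hf⟩ : ∃ f, y = a f ∨ y = star (a f) := by
        obtain ⟨f, hf⟩ | ⟨f, hf⟩ := hl.1
        · exact ⟨f, Or.inl hf.symm⟩
        · exact ⟨f, Or.inr hf.symm⟩
      refine ⟨V ⊔ Submodule.span ℂ {f}, inferInstance, List.forall_mem_cons.2 ⟨⟨f, ?_, hf⟩, ?_⟩⟩
      · exact le_sup_right (a := V) (Submodule.mem_span_singleton_self f)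
      · intro z hz
        obtain ⟨g, hg, hg'⟩ := h z hz
        exact ⟨g, le_sup_left (a := V) hg, hg'⟩
  obtain ⟨V, _, hV⟩ := hV
  obtain ⟨u, hu, h⟩ := ha.exists_parity V
  have hul := mul_list_prod_of_anticommute (u := u) (l := l) fun y hy => by
    obtain ⟨f, hf, rfl | rfl⟩ := hV y hy
    · exact (h f hf).1
    · exact (h f hf).2
  rw [hodd.neg_one_pow, neg_one_mul] at hul
  have h1 : τ (u * (l.prod * u)) = τ l.prod := by rw [hτ, mul_assoc, hu, mul_one]
  have h2 : τ (u * (l.prod * u)) = -τ l.prod := by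
    rw [← mul_assoc, hul, neg_mul, mul_assoc, hu, mul_one, map_neg]
  exact self_eq_neg.1 (h1.symm.trans h2)

end IsCAR
end Parity

/-- The *-algebra generated by `s` is spanned by the words in `s` and its adjoints. -/
theorem mem_span_words_of_mem_adjoin {R : Type*} [Ring R] [StarRing R] [Algebra ℂ R]
    [StarModule ℂ R] {s : Set R} {x : R} (hx : x ∈ StarAlgebra.adjoin ℂ s) :
    x ∈ Submodule.span ℂ {x | ∃ l : List R, (∀ y ∈ l, y ∈ s ∪ star s) ∧ x = l.prod} := by
  rw [← StarSubalgebra.mem_toSubalgebra, StarAlgebra.adjoin_toSubalgebra,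
    ← Subalgebra.mem_toSubmodule, Algebra.adjoin_eq_span] at hx
  refine Submodule.span_mono (fun y hy => ?_) hx
  obtain ⟨l, hl, rfl⟩ := Submonoid.exists_list_of_mem_closure hy
  exact ⟨l, hl, rfl⟩

theorem star_list_prod {R : Type*} [Monoid R] [StarMul R] (l : List R) :
    star l.prod = (l.reverse.map star).prod := by
  induction l with
  | nil => simp
  | cons x l ih => simp [ih]

/-! ### The parity operator and the twisted right fields -/

section Fields

variable {H 𝒜 K : Type*} [NormedAddCommGroup H] [InnerProductSpace ℂ H] [CStarAlgebra 𝒜]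
  [NormedAddCommGroup K] [InnerProductSpace ℂ K] [CompleteSpace K]

theorem range_union_star_range {R : Type*} [Ring R] [StarRing R] [Algebra ℂ R]
    (a : H →ₗ⋆[ℂ] R) :
    Set.range (fun f => a f) ∪ star (Set.range fun f => a f) = generators a := by
  rw [generators, ← Set.image_star, ← Set.range_comp]
  rfl

/-- A closed subspace of the CAR algebra which contains all words in the fields is everything. -/
theorem IsCARAlgebra.mem_of_words {a : H →ₗ⋆[ℂ] 𝒜} (ha : IsCARAlgebra a) {V : Submodule ℂ 𝒜}
    (hV : IsClosed (V : Set 𝒜))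
    (hw : ∀ l : List 𝒜, (∀ y ∈ l, y ∈ generators a) → l.prod ∈ V) (x : 𝒜) : x ∈ V := by
  refine closure_minimal ?_ hV (ha.dense x)
  intro y hy
  refine Submodule.span_le.2 ?_ (mem_span_words_of_mem_adjoin hy)
  rintro _ ⟨l, hl, rfl⟩
  exact hw l (by rwa [range_union_star_range] at hl)

variable {π : 𝒜 →⋆ₐ[ℂ] (K →L[ℂ] K)} {Ω : K} {a : H →ₗ⋆[ℂ] 𝒜}

theorem IsCARAlgebra.clm_ext (ha : IsCARAlgebra a) (h : IsTracialVector π Ω) {S T : K →L[ℂ] K}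
    (hST : ∀ l : List 𝒜, (∀ y ∈ l, y ∈ generators a) → S (π l.prod Ω) = T (π l.prod Ω)) :
    S = T := by
  refine h.clm_ext fun x => ?_
  have hπ : Continuous π := map_continuous π
  let V : Submodule ℂ 𝒜 := LinearMap.ker (((S - T : K →L[ℂ] K) : K →ₗ[ℂ] K) ∘ₗ
    (ContinuousLinearMap.apply ℂ K Ω).toLinearMap ∘ₗ (π : 𝒜 →ₗ[ℂ] (K →L[ℂ] K)))
  have hmem : ∀ x, x ∈ V ↔ S (π x Ω) = T (π x Ω) := fun x => by
    rw [← sub_eq_zero]; rfl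
  refine (hmem x).1 (ha.mem_of_words ?_ (fun l hl => (hmem _).2 (hST l hl)) x)
  have : (V : Set 𝒜) = {x | S (π x Ω) = T (π x Ω)} := Set.ext hmem
  rw [this]
  exact isClosed_eq (by fun_prop) (by fun_prop)

theorem IsCARAlgebra.commute_of_generators (ha : IsCARAlgebra a) {T : K →L[ℂ] K}
    (hT : ∀ c ∈ generators a, Commute T (π c)) (x : 𝒜) : Commute T (π x) := by
  have hπ : Continuous π := map_continuous π
  let V : Submodule ℂ 𝒜 :=
    (Subalgebra.toSubmodule ((Subalgebra.centralizer ℂ {T}).comap (π : 𝒜 →ₐ[ℂ] (K →L[ℂ] K))))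
  have hmem : ∀ x, x ∈ V ↔ T * π x = π x * T := fun x => by
    change (π x ∈ Subalgebra.centralizer ℂ {T}) ↔ _
    simp [Subalgebra.mem_centralizer_iff]
  refine (hmem x).1 (ha.mem_of_words ?_ (fun l hl => ?_) x)
  · have : (V : Set 𝒜) = {x | T * π x = π x * T} := Set.ext hmem
    rw [this]
    exact isClosed_eq (by fun_prop) (by fun_prop)
  · exact Subalgebra.list_prod_mem
      ((Subalgebra.centralizer ℂ {T}).comap (π : 𝒜 →ₐ[ℂ] (K →L[ℂ] K)))
      fun y hy => (hmem y).2 (hT y (hl y hy))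

/-- `W` is the self-adjoint operator which is `1` on even and `-1` on odd words in the fields
applied to `Ω`. -/
structure IsParityOperator (π : 𝒜 →⋆ₐ[ℂ] (K →L[ℂ] K)) (Ω : K) (a : H →ₗ⋆[ℂ] 𝒜)
    (W : K →L[ℂ] K) : Prop where
  star_eq : star W = W
  apply_word : ∀ l : List 𝒜, (∀ y ∈ l, y ∈ generators a) →
    W (π l.prod Ω) = (-1 : ℂ) ^ l.length • π l.prod Ω

/-- Since the trace of odd words vanishes, even and odd words give orthogonal vectors, and the
parity operator is `2 P - 1`, with `P` the projection onto the closed span of the even words. -/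
theorem IsCARAlgebra.exists_parityOperator (ha : IsCARAlgebra a) (h : IsTracialVector π Ω) :
    ∃ W : K →L[ℂ] K, IsParityOperator π Ω a W := by
  let E₀ : Submodule ℂ K := Submodule.span ℂ
    {v | ∃ l : List 𝒜, (∀ y ∈ l, y ∈ generators a) ∧ Even l.length ∧ v = π l.prod Ω}
  let E := E₀.topologicalClosure
  let τ : 𝒜 →ₗ[ℂ] ℂ := (innerSL ℂ Ω).toLinearMap ∘ₗ
    (ContinuousLinearMap.apply ℂ K Ω).toLinearMap ∘ₗ (π : 𝒜 →ₗ[ℂ] (K →L[ℂ] K))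
  refine ⟨(2 : ℂ) • E.starProjection - 1, ?_, fun l hl => ?_⟩
  · have : star E.starProjection = E.starProjection := isSelfAdjoint_starProjection E
    rw [star_sub, star_smul, this, star_one]
    simp
  · obtain hn | hn := Nat.even_or_odd l.length
    · have hmem : π l.prod Ω ∈ E :=
        E₀.le_topologicalClosure (Submodule.subset_span ⟨l, hl, hn, rfl⟩)
      simp only [sub_apply, smul_apply, hn.neg_one_pow, one_smul,
        Submodule.starProjection_eq_self_iff.2 hmem]
      rw [two_smul]
      exact add_sub_cancel_right _ _
    · have hmem : π l.prod Ω ∈ Eᗮ := by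
        rw [Submodule.orthogonal_closure]
        refine (Submodule.mem_orthogonal _ _).2 fun u hu => ?_
        induction hu using Submodule.span_induction with
        | zero => simp
        | add x y _ _ hx hy => rw [inner_add_left, hx, hy, add_zero]
        | smul c x _ hx => rw [inner_smul_left, hx, mul_zero]
        | mem x hx =>
          obtain ⟨m, hm, hme, rfl⟩ := hx
          rw [inner_representation, star_list_prod, ← List.prod_append]
          refine ha.isCAR.trace_odd (τ := τ) h.trace ?_ ?_
          · intro y hy
            obtain hy | hy := List.mem_append.1 hy
            · obtain ⟨z, hz, rfl⟩ := List.mem_map.1 hy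
              exact star_mem_generators (hm z (List.mem_reverse.1 hz))
            · exact hl y hy
          · simpa using hme.add_odd hn
      simp only [sub_apply, smul_apply, hn.neg_one_pow]
      rw [(Submodule.starProjection_apply_eq_zero_iff _).2 hmem]
      simp

namespace IsParityOperator

variable {W : K →L[ℂ] K} (hW : IsParityOperator π Ω a W)
include hW

theorem apply_vector : W Ω = Ω := by
  simpa using hW.apply_word [] (by simp)

theorem mul_self (ha : IsCARAlgebra a) (h : IsTracialVector π Ω) : W * W = 1 := by
  refine ha.clm_ext h fun l hl => ?_
  change W (W _) = _
  rw [hW.apply_word l hl, map_smul, hW.apply_word l hl, smul_smul, ← mul_pow]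
  simp

theorem mul_representation (ha : IsCARAlgebra a) (h : IsTracialVector π Ω) {c : 𝒜}
    (hc : c ∈ generators a) : W * π c = -(π c * W) := by
  refine ha.clm_ext h fun l hl => ?_
  have h1 : π c (π l.prod Ω) = π (c :: l).prod Ω := by rw [List.prod_cons, map_mul]; rfl
  change W (π c (π l.prod Ω)) = -(π c (W (π l.prod Ω)))
  rw [h1, hW.apply_word _ (List.forall_mem_cons.2 ⟨hc, hl⟩), hW.apply_word l hl, map_smul, h1,
    List.length_cons, pow_succ]
  simp

variable {J : K ≃ₗᵢ⋆[ℂ] K}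

theorem conjugate_eq (hJ : IsTracialConjugation π Ω J) (ha : IsCARAlgebra a)
    (h : IsTracialVector π Ω) : conjugate J W = W := by
  refine ha.clm_ext h fun l hl => ?_
  have hl' : ∀ y ∈ (l.reverse.map star), y ∈ generators a := fun y hy => by
    obtain ⟨z, hz, rfl⟩ := List.mem_map.1 hy
    exact star_mem_generators (hl z (List.mem_reverse.1 hz))
  rw [conjugate_apply, hJ, star_list_prod, hW.apply_word _ hl', hW.apply_word l hl,
    LinearIsometryEquiv.map_smulₛₗ, hJ, ← star_list_prod, star_star]
  simp

theorem mul_conjugate (hJ : IsTracialConjugation π Ω J) (ha : IsCARAlgebra a)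
    (h : IsTracialVector π Ω) {c : 𝒜} (hc : c ∈ generators a) :
    W * conjugate J (π c) = -(conjugate J (π c) * W) := by
  have := congr_arg (conjugate J) (hW.mul_representation ha h hc)
  rw [← neg_one_smul ℂ, conjugate_smul, conjugate_mul (hJ.involutive h),
    conjugate_mul (hJ.involutive h), hW.conjugate_eq hJ ha h] at this
  simpa using this

end IsParityOperator

/-- The twisted right fields `b(f) = W J a(f)* J`. -/
def twistedField (π : 𝒜 →⋆ₐ[ℂ] (K →L[ℂ] K)) (a : H →ₗ⋆[ℂ] 𝒜) (J : K ≃ₗᵢ⋆[ℂ] K)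
    (W : K →L[ℂ] K) : H →ₗ⋆[ℂ] (K →L[ℂ] K) where
  toFun f := W * conjugate J (star (π (a f)))
  map_add' f g := by simp [conjugate_add, mul_add]
  map_smul' c f := by simp [conjugate_smul]

/-- The fields in a representation of the CAR algebra. -/
def representedField (π : 𝒜 →⋆ₐ[ℂ] (K →L[ℂ] K)) (a : H →ₗ⋆[ℂ] 𝒜) : H →ₗ⋆[ℂ] (K →L[ℂ] K) :=
  (π : 𝒜 →ₗ[ℂ] (K →L[ℂ] K)).comp a

@[simp]
theorem representedField_apply (f : H) : representedField π a f = π (a f) := rfl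

variable {W : K →L[ℂ] K} {J : K ≃ₗᵢ⋆[ℂ] K}

theorem twistedField_apply (f : H) :
    twistedField π a J W f = W * conjugate J (π (star (a f))) := by
  rw [map_star]; rfl

theorem star_twistedField (h : IsTracialVector π Ω) (hJ : IsTracialConjugation π Ω J)
    (hW : IsParityOperator π Ω a W) (f : H) :
    star (twistedField π a J W f) = conjugate J (π (a f)) * W := by
  rw [twistedField_apply, star_mul, hW.star_eq, star_conjugate (hJ.involutive h), ← map_star,
    star_star]

theorem parity_mul_twistedField (ha : IsCARAlgebra a) (h : IsTracialVector π Ω)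
    (hW : IsParityOperator π Ω a W) (f : H) :
    W * twistedField π a J W f = conjugate J (π (star (a f))) := by
  rw [twistedField_apply, ← mul_assoc, hW.mul_self ha h, one_mul]

section

variable (ha : IsCARAlgebra a) (h : IsTracialVector π Ω) (hJ : IsTracialConjugation π Ω J)
  (hW : IsParityOperator π Ω a W)
include ha h hJ hW

theorem star_twistedField_mul_parity (f : H) :
    star (twistedField π a J W f) * W = conjugate J (π (a f)) := by
  rw [star_twistedField h hJ hW, mul_assoc, hW.mul_self ha h, mul_one]

/-- Left and right multiplications commute; the factor `W` makes the twisted right fields anticommute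
with the left ones. -/
theorem anticommute_twistedField {c : 𝒜} (hc : c ∈ generators a) {x : K →L[ℂ] K}
    (hx : x ∈ generators (twistedField π a J W)) : π c * x = -(x * π c) := by
  have hWc := hW.mul_representation ha h hc
  obtain ⟨g, rfl⟩ | ⟨g, rfl⟩ := hx
  · simp only [twistedField_apply]
    rw [← mul_assoc, ← neg_eq_iff_eq_neg.2 hWc, neg_mul, mul_assoc, mul_assoc,
      (hJ.commute h _ _).eq]
  · simp only [star_twistedField h hJ hW]
    rw [← mul_assoc, ← (hJ.commute h _ _).eq, mul_assoc, mul_assoc, hWc, mul_neg, neg_neg]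

/-- Right multiplication reverses products, to which the relations are insensitive, and the signs
from moving `W` agree in both terms of each anticommutator. -/
theorem isCAR_twistedField : IsCAR (twistedField π a J W) := by
  have hJ2 := hJ.involutive h
  have hWW := hW.mul_self ha h
  have hρ : ∀ x y, conjugate J (π x) * conjugate J (π y) = conjugate J (π (x * y)) := fun x y => by
    rw [map_mul, conjugate_mul hJ2]
  have hadd : ∀ x y, conjugate J (π x) + conjugate J (π y) = conjugate J (π (x + y)) :=
    fun x y => by rw [map_add, conjugate_add]
  constructor
  · intro f g
    have hb : ∀ f g, twistedField π a J W f * twistedField π a J W g =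
        -conjugate J (π (star (a f) * star (a g))) := fun f g => by
      rw [twistedField_apply, hW.mul_conjugate hJ ha h (mem_generators_right a f), neg_mul,
        mul_assoc, parity_mul_twistedField ha h hW, hρ]
    rw [hb, hb, ← neg_add, hadd, ← star_mul, ← star_mul, ← star_add, ha.isCAR.anti]
    ext; simp
  · intro f g
    have h1 : twistedField π a J W f * star (twistedField π a J W g) =
        conjugate J (π (star (a f) * a g)) := by
      rw [twistedField_apply, star_twistedField h hJ hW,
        hW.mul_conjugate hJ ha h (mem_generators_right a f), neg_mul, mul_assoc, ← mul_assoc W,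
        hW.mul_conjugate hJ ha h (mem_generators_left a g), neg_mul, mul_assoc _ W, hWW, mul_one,
        mul_neg, neg_neg, hρ]
    have h2 : star (twistedField π a J W g) * twistedField π a J W f =
        conjugate J (π (a g * star (a f))) := by
      rw [star_twistedField h hJ hW, mul_assoc, parity_mul_twistedField ha h hW, hρ]
    rw [h1, h2, hadd, add_comm, ha.isCAR.car, AlgHomClass.commutes, Algebra.algebraMap_eq_smul_one,
      Algebra.algebraMap_eq_smul_one, conjugate_smul, conjugate_one hJ2, inner_conj_symm]

theorem isDoubleCAR_twistedField :
    IsDoubleCAR (representedField π a) (twistedField π a J W) where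
  left :=
    { anti f g := by
        simp only [representedField_apply, ← map_mul, ← map_add, ha.isCAR.anti, map_zero]
      car f g := by
        simp only [representedField_apply, ← map_star, ← map_mul, ← map_add, ha.isCAR.car]
        exact AlgHomClass.commutes π _ }
  right := isCAR_twistedField ha h hJ hW
  anti f g := eq_neg_iff_add_eq_zero.1 <|
    anticommute_twistedField ha h hJ hW (mem_generators_left a f) (mem_generators_left _ g)
  anti_star f g := eq_neg_iff_add_eq_zero.1 <|
    anticommute_twistedField ha h hJ hW (mem_generators_left a f) (mem_generators_right _ g)

/-- A word of even length in the `b(f)`, `b*(f)` picks up an even number of signs when it passes a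
left field. -/
theorem commute_of_mem_evenPolynomials {x : K →L[ℂ] K}
    (hx : x ∈ (evenPolynomials (generators (twistedField π a J W))).topologicalClosure) (y : 𝒜) :
    Commute x (π y) := by
  refine ha.commute_of_generators (fun c hc => ?_) y
  have hcl : IsClosed {x : K →L[ℂ] K | x * π c = π c * x} :=
    isClosed_eq (by fun_prop) (by fun_prop)
  refine closure_minimal ?_ hcl hx
  intro z hz
  change z * π c = π c * z
  induction hz using Submodule.span_induction with
  | zero => simp
  | add x y _ _ hx hy => rw [add_mul, mul_add, hx, hy]
  | smul r x _ hx => rw [smul_mul_assoc, mul_smul_comm, hx]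
  | mem x hx =>
    obtain ⟨l, hl, hn, rfl⟩ := hx
    rw [mul_list_prod_of_anticommute fun y hy =>
      anticommute_twistedField ha h hJ hW hc (hl y hy), hn.neg_one_pow, one_mul]

/-- The operators `W b(f)` and `b*(f) W` are the right multiplications by the fields; they have the
same commutant as all right multiplications, and the commutation theorem applies. -/
theorem centralizer_twistedField :
    Set.centralizer (Set.centralizer
        (Set.range (fun f => W * twistedField π a J W f) ∪
          Set.range (fun g => star (twistedField π a J W g) * W))) =
      Set.centralizer (Set.range π) := by
  rw [← hJ.commutation_theorem h]
  congr 1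
  have hJ2 := hJ.involutive h
  simp only [parity_mul_twistedField ha h hW, star_twistedField_mul_parity ha h hJ hW]
  apply Set.Subset.antisymm
  · intro T hT
    have hc : ∀ x, Commute (conjugate J T) (π x) := by
      refine ha.commute_of_generators fun c hc => ?_
      have hTc : conjugate J (π c) * T = T * conjugate J (π c) := by
        obtain ⟨f, rfl⟩ | ⟨f, rfl⟩ := hc
        · exact hT _ (Or.inr ⟨f, rfl⟩)
        · exact hT _ (Or.inl ⟨f, rfl⟩)
      have := congr_arg (conjugate J) hTc
      rw [conjugate_mul hJ2, conjugate_mul hJ2, conjugate_conjugate hJ2] at this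
      exact this.symm
    rintro _ ⟨x, rfl⟩
    have := congr_arg (conjugate J) (hc x).eq
    rw [conjugate_mul hJ2, conjugate_mul hJ2, conjugate_conjugate hJ2] at this
    exact this.symm
  · refine Set.centralizer_subset ?_
    rintro _ (⟨f, rfl⟩ | ⟨f, rfl⟩)
    · exact ⟨_, rfl⟩
    · exact ⟨_, rfl⟩

end

end Fields

/-! ### Words in the doubled CAR algebra -/

section Letters

variable {H R : Type*} [NormedAddCommGroup H] [InnerProductSpace ℂ H]
  [Ring R] [StarRing R] [Algebra ℂ R]

/-- The annihilation operator of one of two families: `A(f)` for `inl f` and `B(f)` for `inr f`. -/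
def annihilator (A B : H →ₗ⋆[ℂ] R) : H ⊕ H → R := Sum.elim (fun f => A f) fun f => B f

/-- The operator denoted by a letter: a creation operator if the flag is `true`, and an annihilation
operator otherwise. -/
def letter (A B : H →ₗ⋆[ℂ] R) (c : (H ⊕ H) × Bool) : R :=
  if c.2 then star (annihilator A B c.1) else annihilator A B c.1

/-- The product of the operators denoted by the letters of a word. -/
def word (A B : H →ₗ⋆[ℂ] R) (l : List ((H ⊕ H) × Bool)) : R := (l.map (letter A B)).prod

/-- The value of the anticommutator of an annihilation operator with a letter in the doubled CAR
algebra. -/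
def contraction : H ⊕ H → (H ⊕ H) × Bool → ℂ
  | .inl f, (.inl g, true) => ⟪f, g⟫_ℂ
  | .inr f, (.inr g, true) => ⟪f, g⟫_ℂ
  | _, _ => 0

theorem word_cons (A B : H →ₗ⋆[ℂ] R) (c : (H ⊕ H) × Bool) (l : List ((H ⊕ H) × Bool)) :
    word A B (c :: l) = letter A B c * word A B l := by simp [word]

theorem word_append (A B : H →ₗ⋆[ℂ] R) (l m : List ((H ⊕ H) × Bool)) :
    word A B (l ++ m) = word A B l * word A B m := by simp [word]

theorem star_word (A B : H →ₗ⋆[ℂ] R) (l : List ((H ⊕ H) × Bool)) :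
    star (word A B l) = word A B (l.reverse.map fun c => (c.1, !c.2)) := by
  have hs : ∀ c, star (letter A B c) = letter A B (c.1, !c.2) := by
    rintro ⟨x, _ | _⟩ <;> simp [letter]
  rw [word, star_list_prod, word, List.map_map, ← List.map_reverse, List.map_map]
  congr 1
  exact List.map_congr_left fun c _ => hs c

theorem mem_range_letter (A B : H →ₗ⋆[ℂ] R) {x : R}
    (hx : x ∈ generators A ∪ generators B) : x ∈ Set.range (letter A B) := by
  obtain (⟨f, rfl⟩ | ⟨f, rfl⟩) | (⟨f, rfl⟩ | ⟨f, rfl⟩) := hx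
  · exact ⟨(.inl f, false), rfl⟩
  · exact ⟨(.inl f, true), rfl⟩
  · exact ⟨(.inr f, false), rfl⟩
  · exact ⟨(.inr f, true), rfl⟩

theorem IsDoubleCAR.anticommutator {A B : H →ₗ⋆[ℂ] R} (h : IsDoubleCAR A B) (x : H ⊕ H)
    (d : (H ⊕ H) × Bool) :
    annihilator A B x * letter A B d + letter A B d * annihilator A B x =
      algebraMap ℂ R (contraction x d) := by
  obtain f | f := x <;> obtain ⟨g | g, _ | _⟩ := d <;>
    simp only [annihilator, letter, contraction, Sum.elim_inl, Sum.elim_inr, map_zero, if_true,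
      Bool.false_eq_true, if_false]
  · exact h.left.anti f g
  · exact h.left.car f g
  · exact h.anti f g
  · exact h.anti_star f g
  · rw [add_comm]; exact h.anti g f
  · simpa using congr_arg star (h.anti_star g f)
  · exact h.right.anti f g
  · exact h.right.car f g

end Letters

/-! ### Uniqueness of the vacuum representation -/

section Uniqueness

variable {H F F' : Type*} [NormedAddCommGroup H] [InnerProductSpace ℂ H]
  [NormedAddCommGroup F] [InnerProductSpace ℂ F] [CompleteSpace F]
  [NormedAddCommGroup F'] [InnerProductSpace ℂ F'] [CompleteSpace F']
  {A B : H →ₗ⋆[ℂ] (F →L[ℂ] F)} {Ω : F} {A' B' : H →ₗ⋆[ℂ] (F' →L[ℂ] F')} {Ω' : F'}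

namespace IsVacuumRepresentation

theorem annihilator_apply (h : IsVacuumRepresentation A B Ω) (x : H ⊕ H) :
    annihilator A B x Ω = 0 := by
  obtain f | f := x
  · exact h.annihilate_left f
  · exact h.annihilate_right f

theorem inner_word_annihilator_cons (h : IsDoubleCAR A B) (Ω : F) (x : H ⊕ H)
    (u : List ((H ⊕ H) × Bool)) (d : (H ⊕ H) × Bool) (v : List ((H ⊕ H) × Bool)) :
    ⟪Ω, word A B u (annihilator A B x (word A B (d :: v) Ω))⟫_ℂ =
      contraction x d * ⟪Ω, word A B (u ++ v) Ω⟫_ℂ -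
        ⟪Ω, word A B (u ++ [d]) (annihilator A B x (word A B v Ω))⟫_ℂ := by
  have h1 : word A B u * (annihilator A B x * word A B (d :: v)) =
      contraction x d • word A B (u ++ v) -
        word A B (u ++ [d]) * (annihilator A B x * word A B v) := by
    rw [word_cons, ← mul_assoc (annihilator A B x), eq_sub_of_add_eq (h.anticommutator x d),
      sub_mul, mul_sub, word_append, word_append, word_cons, Algebra.algebraMap_eq_smul_one]
    simp [word, mul_assoc]
  have h2 := congr_arg (fun T : F →L[ℂ] F => ⟪Ω, T Ω⟫_ℂ) h1
  simp only [sub_apply, smul_apply, inner_sub_right, inner_smul_right] at h2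
  exact h2

/-- An annihilation operator is moved to the right through a word, until it meets the vacuum; the
contractions which occur on the way leave shorter words. -/
theorem vacuum_expectation_annihilator (h : IsVacuumRepresentation A B Ω)
    (h' : IsVacuumRepresentation A' B' Ω') {n : ℕ}
    (ih : ∀ m : List ((H ⊕ H) × Bool), m.length < n →
      ⟪Ω, word A B m Ω⟫_ℂ = ⟪Ω', word A' B' m Ω'⟫_ℂ)
    (x : H ⊕ H) (u v : List ((H ⊕ H) × Bool)) (hn : u.length + v.length ≤ n) :
    ⟪Ω, word A B u (annihilator A B x (word A B v Ω))⟫_ℂ =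
      ⟪Ω', word A' B' u (annihilator A' B' x (word A' B' v Ω'))⟫_ℂ := by
  induction v generalizing u with
  | nil => simp [word, h.annihilator_apply, h'.annihilator_apply]
  | cons d v ihv =>
    rw [List.length_cons] at hn
    rw [inner_word_annihilator_cons h.isDoubleCAR, inner_word_annihilator_cons h'.isDoubleCAR,
      ih (u ++ v) (by simp; omega), ihv (u ++ [d]) (by simp; omega)]

/-- The vacuum expectations of words are determined by the relations. -/
theorem vacuum_expectation_eq (h : IsVacuumRepresentation A B Ω)
    (h' : IsVacuumRepresentation A' B' Ω') (l : List ((H ⊕ H) × Bool)) :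
    ⟪Ω, word A B l Ω⟫_ℂ = ⟪Ω', word A' B' l Ω'⟫_ℂ := by
  induction hn : l.length using Nat.strong_induction_on generalizing l with
  | h n ih =>
    subst hn
    match l with
    | [] => simp [word, inner_self_eq_norm_sq_to_K, h.norm_vacuum, h'.norm_vacuum]
    | (x, true) :: v =>
      -- The adjoint of a leading creation operator annihilates the vacuum on the left.
      simp only [word_cons, letter, if_true, mul_apply_eq_comp, inner_apply_star,
        h.annihilator_apply, h'.annihilator_apply, inner_zero_left]
    | (x, false) :: v =>
      have := vacuum_expectation_annihilator h h' (n := v.length)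
        (fun m hm => ih m.length (by simp; omega) m rfl) x [] v (by simp)
      simpa [word, letter] using this

theorem inner_word_word (h : IsVacuumRepresentation A B Ω) (h' : IsVacuumRepresentation A' B' Ω')
    (l m : List ((H ⊕ H) × Bool)) :
    ⟪word A B l Ω, word A B m Ω⟫_ℂ = ⟪word A' B' l Ω', word A' B' m Ω'⟫_ℂ := by
  rw [← inner_apply_star, ← inner_apply_star, star_word, star_word,
    ← mul_apply_eq_comp, ← mul_apply_eq_comp, ← word_append,
    ← word_append, vacuum_expectation_eq h h']

/-- The words applied to the vacuum span a dense subspace, by cyclicity. -/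
theorem denseRange_word (h : IsVacuumRepresentation A B Ω) :
    DenseRange (Finsupp.linearCombination ℂ fun l => word A B l Ω) := by
  refine h.cyclic.mono ?_
  rintro _ ⟨x, hx, rfl⟩
  rw [← LinearMap.coe_range, Finsupp.range_linearCombination]
  change x ∈ (Submodule.span ℂ (Set.range fun l => word A B l Ω)).comap
    (ContinuousLinearMap.apply ℂ F Ω).toLinearMap
  refine Submodule.span_le.2 ?_ (mem_span_words_of_mem_adjoin hx)
  rintro _ ⟨l, hl, rfl⟩
  have hl' : ∀ y ∈ l, y ∈ Set.range (letter A B) := fun y hy => mem_range_letter A B (by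
    rw [← range_union_star_range, ← range_union_star_range]
    have := hl y hy
    simp only [Set.union_star] at this
    simp only [Set.mem_union] at this ⊢
    tauto)
  obtain ⟨m, rfl⟩ : l ∈ Set.range (List.map (letter A B)) := by
    rw [Set.range_list_map]
    exact hl'
  exact Submodule.subset_span ⟨m, rfl⟩

/-- Two vacuum representations of the doubled CAR algebra are unitarily equivalent. -/
theorem exists_unitary (h : IsVacuumRepresentation A B Ω) (h' : IsVacuumRepresentation A' B' Ω') :
    ∃ U : F ≃ₗᵢ[ℂ] F', U Ω = Ω' ∧ (∀ f ψ, U (A f ψ) = A' f (U ψ)) ∧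
      ∀ f ψ, U (B f ψ) = B' f (U ψ) := by
  let V := Finsupp.linearCombination ℂ fun l => word A B l Ω
  let V' := Finsupp.linearCombination ℂ fun l => word A' B' l Ω'
  have hV : DenseRange V := h.denseRange_word
  have hV' : DenseRange V' := h'.denseRange_word
  have hn : ∀ p, ‖V' (LinearEquiv.refl ℂ _ p)‖ = ‖V p‖ := fun p => by
    have h2 : ⟪V' p, V' p⟫_ℂ = ⟪V p, V p⟫_ℂ := by
      simp only [V, V', Finsupp.linearCombination_apply, Finsupp.sum, sum_inner, inner_sum,
        inner_smul_left, inner_smul_right, inner_word_word h h']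
    rw [inner_self_eq_norm_sq_to_K, inner_self_eq_norm_sq_to_K] at h2
    exact (pow_left_inj₀ (norm_nonneg _) (norm_nonneg _) two_ne_zero).1 (by exact_mod_cast h2)
  let U := (LinearEquiv.refl ℂ (List ((H ⊕ H) × Bool) →₀ ℂ)).extendOfIsometry V V' hV hV' hn
  have hU : ∀ p, U (V p) = V' p := fun p =>
    LinearEquiv.extendOfIsometry_eq (LinearEquiv.refl ℂ _) V V' hV hV' hn p
  have hword : ∀ l, U (word A B l Ω) = word A' B' l Ω' := fun l => by
    have := hU (Finsupp.single l 1)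
    simpa [V, V'] using this
  have hletter : ∀ c ψ, U (letter A B c ψ) = letter A' B' c (U ψ) := fun c ψ => by
    refine congr_fun (hV.equalizer (g := fun ψ => U (letter A B c ψ))
      (h := fun ψ => letter A' B' c (U ψ)) ?_ ?_ (funext fun p => ?_)) ψ
    · exact U.continuous.comp (letter A B c).continuous
    · exact (letter A' B' c).continuous.comp U.continuous
    · have hc : ∀ l, U (letter A B c (word A B l Ω)) = letter A' B' c (U (word A B l Ω)) :=
        fun l => by
          have := hword (c :: l)
          rw [word_cons, word_cons] at this
          rw [hword l]
          exact this
      simp only [Function.comp_apply]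
      induction p using Finsupp.induction_linear with
      | zero => simp
      | add p q hp hq => simp only [map_add, hp, hq]
      | single l z => simp [V, hc]
  refine ⟨U, ?_, fun f => hletter (.inl f, false), fun f => hletter (.inr f, false)⟩
  simpa [word] using hword []

end IsVacuumRepresentation
end Uniqueness

/-! ### The Bogoliubov transformation -/

section Bogoliubov

variable {H R : Type*} [NormedAddCommGroup H] [InnerProductSpace ℂ H]
  [Ring R] [StarRing R] [Algebra ℂ R] [StarModule ℂ R]

/-- The field `A(f) = (a(f) + b(f)) / √2`. -/
def bogoliubovLeft (a b : H →ₗ⋆[ℂ] R) : H →ₗ⋆[ℂ] R := ((1 / √2 : ℝ) : ℂ) • (a + b)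

/-- The field `B(f) = (a*(f̄) - b*(f̄)) / √2`. -/
def bogoliubovRight (conj : H ≃ₗᵢ⋆[ℂ] H) (a b : H →ₗ⋆[ℂ] R) : H →ₗ⋆[ℂ] R where
  toFun f := ((1 / √2 : ℝ) : ℂ) • (star (a (conj f)) - star (b (conj f)))
  map_add' f g := by
    simp only [map_add, star_add]
    module
  map_smul' c f := by
    simp only [LinearIsometryEquiv.map_smulₛₗ, LinearMap.map_smulₛₗ, star_smul, RCLike.star_def,
      Complex.conj_conj]
    module

variable {a b : H →ₗ⋆[ℂ] R} {conj : H ≃ₗᵢ⋆[ℂ] H}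

theorem star_inv_sqrt_two : star ((1 / √2 : ℝ) : ℂ) = ((1 / √2 : ℝ) : ℂ) := Complex.conj_ofReal _

theorem inv_sqrt_two_mul_self : ((1 / √2 : ℝ) : ℂ) * ((1 / √2 : ℝ) : ℂ) = 1 / 2 := by
  rw [← Complex.ofReal_mul, div_mul_div_comm, Real.mul_self_sqrt (by norm_num)]
  norm_num

omit [StarRing R] [StarModule ℂ R] in
theorem bogoliubovLeft_apply (f : H) :
    bogoliubovLeft a b f = ((1 / √2 : ℝ) : ℂ) • (a f + b f) := rfl

theorem bogoliubovRight_apply (f : H) :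
    bogoliubovRight conj a b f =
      ((1 / √2 : ℝ) : ℂ) • (star (a (conj f)) - star (b (conj f))) := rfl

theorem star_bogoliubovLeft (f : H) :
    star (bogoliubovLeft a b f) = ((1 / √2 : ℝ) : ℂ) • (star (a f) + star (b f)) := by
  rw [bogoliubovLeft_apply, star_smul, star_inv_sqrt_two, star_add]

theorem star_bogoliubovRight (f : H) :
    star (bogoliubovRight conj a b f) = ((1 / √2 : ℝ) : ℂ) • (a (conj f) - b (conj f)) := by
  rw [bogoliubovRight_apply, star_smul, star_inv_sqrt_two, star_sub, star_star, star_star]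

theorem bogoliubov_add (hconj : ∀ f, conj (conj f) = f) (f : H) :
    a f = ((1 / √2 : ℝ) : ℂ) • (bogoliubovLeft a b f + star (bogoliubovRight conj a b (conj f))) := by
  rw [star_bogoliubovRight, bogoliubovLeft_apply, hconj, ← smul_add, smul_smul,
    inv_sqrt_two_mul_self]
  module

theorem bogoliubov_sub (hconj : ∀ f, conj (conj f) = f) (f : H) :
    b f = ((1 / √2 : ℝ) : ℂ) • (bogoliubovLeft a b f - star (bogoliubovRight conj a b (conj f))) := by
  rw [star_bogoliubovRight, bogoliubovLeft_apply, hconj, ← smul_sub, smul_smul,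
    inv_sqrt_two_mul_self]
  module

/-- The doubled canonical anticommutation relations are invariant under the Bogoliubov
transformation. -/
theorem IsDoubleCAR.bogoliubov (h : IsDoubleCAR a b) :
    IsDoubleCAR (bogoliubovLeft a b) (bogoliubovRight conj a b) := by
  have h1 := h.left.anti
  have h2 := h.left.car
  have h3 := h.right.anti
  have h4 := h.right.car
  have h5 := h.anti
  have h6 := h.anti_star
  have h5' : ∀ f g, b f * a g + a g * b f = 0 := fun f g => by rw [add_comm]; exact h5 g f
  have h6' : ∀ f g, star (a f) * b g + b g * star (a f) = 0 := fun f g => by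
    simpa [add_comm] using congr_arg star (h6 f g)
  have hs : ∀ x y z w : R, ((1 / √2 : ℝ) : ℂ) • x * ((1 / √2 : ℝ) : ℂ) • y +
      ((1 / √2 : ℝ) : ℂ) • z * ((1 / √2 : ℝ) : ℂ) • w = (1 / 2 : ℂ) • (x * y + z * w) :=
    fun x y z w => by
      rw [smul_mul_smul_comm, smul_mul_smul_comm, inv_sqrt_two_mul_self, smul_add]
  have hsum : ∀ p q p' q' : R, (p + q) * (p' + q') + (p' + q') * (p + q) =
      (p * p' + p' * p) + (q * q' + q' * q) + (p * q' + q' * p) + (q * p' + p' * q) :=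
    fun p q p' q' => by noncomm_ring
  have hdiff : ∀ p q p' q' : R, (p + q) * (p' - q') + (p' - q') * (p + q) =
      (p * p' + p' * p) - (q * q' + q' * q) - (p * q' + q' * p) + (q * p' + p' * q) :=
    fun p q p' q' => by noncomm_ring
  have hdd : ∀ p q p' q' : R, (p - q) * (p' - q') + (p' - q') * (p - q) =
      (p * p' + p' * p) + (q * q' + q' * q) - (p * q' + q' * p) - (q * p' + p' * q) :=
    fun p q p' q' => by noncomm_ring
  have h6'' : ∀ f g, b f * star (a g) + star (a g) * b f = 0 := fun f g => by
    rw [add_comm]; exact h6' g f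
  refine ⟨⟨fun f g => ?_, fun f g => ?_⟩, ⟨fun f g => ?_, fun f g => ?_⟩, fun f g => ?_,
    fun f g => ?_⟩
  · rw [bogoliubovLeft_apply, bogoliubovLeft_apply, hs, hsum, h1, h3, h5, h5']
    simp
  · rw [star_bogoliubovLeft, bogoliubovLeft_apply, hs, hsum, h2, h4, h6, h6'', add_zero, add_zero,
      ← two_smul ℂ, smul_smul]
    norm_num
  · have := congr_arg star (show (a (conj g) - b (conj g)) * (a (conj f) - b (conj f)) +
        (a (conj f) - b (conj f)) * (a (conj g) - b (conj g)) = 0 by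
      rw [hdd, h1, h3, h5, h5']; simp)
    rw [bogoliubovRight_apply, bogoliubovRight_apply, hs]
    simp only [star_add, star_mul, star_sub, star_zero] at this
    rw [this, smul_zero]
  · rw [star_bogoliubovRight, bogoliubovRight_apply, hs, add_comm, hdd, h2, h4, h6, h6'', sub_zero,
      sub_zero, ← two_smul ℂ, smul_smul, inner_map_map_conj]
    norm_num
  · rw [bogoliubovLeft_apply, bogoliubovRight_apply, hs, hdiff, h2, h4, h6, h6'']
    simp
  · rw [bogoliubovLeft_apply, star_bogoliubovRight, hs, hdiff, h1, h3, h5, h5']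
    simp

/-- An element which anticommutes with the fields `a` and `b` anticommutes with the fields of the
Bogoliubov transform. -/
theorem anticommute_bogoliubov {u : R}
    (hu : ∀ x ∈ generators a ∪ generators b, u * x = -(x * u)) {x : R}
    (hx : x ∈ generators (bogoliubovLeft a b) ∪ generators (bogoliubovRight conj a b)) :
    u * x = -(x * u) := by
  have h1 := fun f => hu _ (Or.inl (mem_generators_left a f))
  have h2 := fun f => hu _ (Or.inl (mem_generators_right a f))
  have h3 := fun f => hu _ (Or.inr (mem_generators_left b f))
  have h4 := fun f => hu _ (Or.inr (mem_generators_right b f))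
  obtain (⟨f, rfl⟩ | ⟨f, rfl⟩) | (⟨f, rfl⟩ | ⟨f, rfl⟩) := hx
  · simp only [bogoliubovLeft_apply, mul_smul_comm, smul_mul_assoc, ← smul_neg, mul_add, add_mul,
      h1, h3, neg_add]
  · simp only [star_bogoliubovLeft, mul_smul_comm, smul_mul_assoc, ← smul_neg, mul_add, add_mul,
      h2, h4, neg_add]
  · simp only [bogoliubovRight_apply, mul_smul_comm, smul_mul_assoc, ← smul_neg, mul_sub, sub_mul,
      h2, h4, neg_sub_neg, neg_sub]
  · simp only [star_bogoliubovRight, mul_smul_comm, smul_mul_assoc, ← smul_neg, mul_sub, sub_mul,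
      h1, h3, neg_sub_neg, neg_sub]

end Bogoliubov

/-! ### The even and odd subspaces -/

section ParitySubspaces

variable {F : Type*} [NormedAddCommGroup F] [InnerProductSpace ℂ F] {S : Set (F →L[ℂ] F)} {Ω : F}
  {W : F →L[ℂ] F}

theorem apply_list_prod_of_anticommute (hΩ : W Ω = Ω) (hS : ∀ x ∈ S, W * x = -(x * W))
    {l : List (F →L[ℂ] F)} (hl : ∀ y ∈ l, y ∈ S) :
    W (l.prod Ω) = (-1 : ℂ) ^ l.length • l.prod Ω := by
  have := DFunLike.congr_fun (mul_list_prod_of_anticommute fun y hy => hS y (hl y hy)) Ω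
  rw [mul_apply_eq_comp, mul_apply_eq_comp, mul_apply_eq_comp, hΩ] at this
  obtain hn | hn := Nat.even_or_odd l.length
  · simpa [hn.neg_one_pow] using this
  · simpa [hn.neg_one_pow] using this

theorem apply_of_mem_evenSubspace (hΩ : W Ω = Ω) (hS : ∀ x ∈ S, W * x = -(x * W)) {ψ : F}
    (hψ : ψ ∈ evenSubspace S Ω) : W ψ = ψ := by
  refine closure_minimal ?_ (isClosed_eq W.continuous continuous_id) hψ
  rintro _ ⟨x, hx, rfl⟩
  change W (x Ω) = x Ω
  induction hx using Submodule.span_induction with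
  | zero => simp
  | add x y _ _ hx hy => simp only [add_apply, map_add, hx, hy]
  | smul c x _ hx => simp only [smul_apply, map_smul, hx]
  | mem x hx =>
    obtain ⟨l, hl, hn, rfl⟩ := hx
    rw [apply_list_prod_of_anticommute hΩ hS hl, hn.neg_one_pow, one_smul]

theorem apply_of_mem_oddSubspace (hΩ : W Ω = Ω) (hS : ∀ x ∈ S, W * x = -(x * W)) {ψ : F}
    (hψ : ψ ∈ oddSubspace S Ω) : W ψ = -ψ := by
  refine closure_minimal ?_ (isClosed_eq W.continuous continuous_neg) hψ
  rintro _ ⟨x, hx, rfl⟩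
  change W (x Ω) = -x Ω
  induction hx using Submodule.span_induction with
  | zero => simp
  | add x y _ _ hx hy => simp only [add_apply, map_add, hx, hy, neg_add]
  | smul c x _ hx => simp only [smul_apply, map_smul, hx, smul_neg]
  | mem x hx =>
    obtain ⟨l, hl, hn, rfl⟩ := hx
    rw [apply_list_prod_of_anticommute hΩ hS hl, hn.neg_one_pow, neg_smul, one_smul]

end ParitySubspaces

/-! ### The tracial vector as a vacuum -/

section Vacuum

variable {H 𝒜 K : Type*} [NormedAddCommGroup H] [InnerProductSpace ℂ H] [CStarAlgebra 𝒜]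
  [NormedAddCommGroup K] [InnerProductSpace ℂ K] [CompleteSpace K]
  {π : 𝒜 →⋆ₐ[ℂ] (K →L[ℂ] K)} {Ω : K} {a : H →ₗ⋆[ℂ] 𝒜} {J : K ≃ₗᵢ⋆[ℂ] K} {W : K →L[ℂ] K}

theorem IsParityOperator.anticommute_fields (hW : IsParityOperator π Ω a W)
    (ha : IsCARAlgebra a) (h : IsTracialVector π Ω) (hJ : IsTracialConjugation π Ω J)
    {x : K →L[ℂ] K}
    (hx : x ∈ generators (representedField π a) ∪ generators (twistedField π a J W)) :
    W * x = -(x * W) := by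
  obtain (⟨f, rfl⟩ | ⟨f, rfl⟩) | (⟨f, rfl⟩ | ⟨f, rfl⟩) := hx
  · exact hW.mul_representation ha h (mem_generators_left a f)
  · simp only [representedField_apply, ← map_star]
    exact hW.mul_representation ha h (mem_generators_right a f)
  · simp only [twistedField_apply]
    rw [mul_assoc, ← neg_eq_iff_eq_neg.2 (hW.mul_conjugate hJ ha h (mem_generators_right a f)),
      mul_neg, neg_neg]
  · simp only [star_twistedField h hJ hW]
    rw [← mul_assoc, hW.mul_conjugate hJ ha h (mem_generators_left a f), neg_mul]

/-- On the tracial vector, `b(f)Ω = -a(f)Ω` and `b*(f)Ω = a*(f)Ω`; so `Ω` is a vacuum for the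
Bogoliubov transform of `a` and `b`. -/
theorem isVacuumRepresentation_bogoliubov (conj : H ≃ₗᵢ⋆[ℂ] H)
    (hconj : ∀ f, conj (conj f) = f) (ha : IsCARAlgebra a) (h : IsTracialVector π Ω)
    (hJ : IsTracialConjugation π Ω J) (hW : IsParityOperator π Ω a W) :
    IsVacuumRepresentation (bogoliubovLeft (representedField π a) (twistedField π a J W))
      (bogoliubovRight conj (representedField π a) (twistedField π a J W)) Ω where
  isDoubleCAR := (isDoubleCAR_twistedField ha h hJ hW).bogoliubov
  norm_vacuum := h.norm_eq_one
  annihilate_left f := by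
    have hb : twistedField π a J W f Ω = -π (a f) Ω := by
      rw [twistedField_apply, mul_apply_eq_comp, hJ.conjugate_vector, star_star]
      have := hW.apply_word [a f] (by simpa using mem_generators_left a f)
      simpa using this
    rw [bogoliubovLeft_apply, smul_apply, add_apply, hb, representedField_apply, add_neg_cancel,
      smul_zero]
  annihilate_right f := by
    rw [bogoliubovRight_apply, smul_apply, sub_apply, star_twistedField h hJ hW,
      mul_apply_eq_comp, hW.apply_vector, hJ.conjugate_vector, representedField_apply,
      ← map_star, sub_self, smul_zero]
  cyclic := by
    set S := StarAlgebra.adjoin ℂ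
      (Set.range (fun f => bogoliubovLeft (representedField π a) (twistedField π a J W) f) ∪
        Set.range fun f => bogoliubovRight conj (representedField π a) (twistedField π a J W) f)
    have hS : ∀ f, π (a f) ∈ S := fun f => by
      rw [← representedField_apply, bogoliubov_add (b := twistedField π a J W) hconj]
      exact S.smul_mem (add_mem (StarAlgebra.subset_adjoin _ _ (Or.inl ⟨f, rfl⟩))
        (star_mem (StarAlgebra.subset_adjoin _ _ (Or.inr ⟨conj f, rfl⟩)))) _
    have hle : StarAlgebra.adjoin ℂ (Set.range fun f => a f) ≤ S.comap π := by
      refine StarAlgebra.adjoin_le ?_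
      rintro _ ⟨f, rfl⟩
      exact hS f
    have hπ : Continuous π := map_continuous π
    have hd := h.cyclic.dense_image (by fun_prop) ha.dense
    refine hd.mono ?_
    rintro _ ⟨x, hx, rfl⟩
    exact ⟨π x, hle hx, rfl⟩

end Vacuum

/-! ### The GNS representation of a tracial state -/

section Gns

variable {𝒜 : Type*} [CStarAlgebra 𝒜] [PartialOrder 𝒜] [StarOrderedRing 𝒜] {τ : 𝒜 →ₚ[ℂ] ℂ}

theorem gnsStarAlgHom_apply_gnsVector (x : 𝒜) :
    τ.gnsStarAlgHom x (gnsVector τ) = ((τ.toPreGNS x : τ.PreGNS) : τ.GNS) := by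
  simp [gnsVector, PositiveLinearMap.leftMulMapPreGNS_apply]

theorem inner_gnsVector (x : 𝒜) :
    ⟪gnsVector τ, τ.gnsStarAlgHom x (gnsVector τ)⟫_ℂ = τ x := by
  rw [gnsStarAlgHom_apply_gnsVector, gnsVector, UniformSpace.Completion.inner_coe,
    PositiveLinearMap.preGNS_inner_def]
  simp

theorem IsTracialState.isTracialVector (hτ : IsTracialState τ) :
    IsTracialVector τ.gnsStarAlgHom (gnsVector τ) where
  norm_eq_one := by
    have h := inner_gnsVector (τ := τ) 1
    rw [hτ.map_one, gnsStarAlgHom_apply_gnsVector] at h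
    change ⟪gnsVector τ, gnsVector τ⟫_ℂ = 1 at h
    have h2 : ‖gnsVector τ‖ ^ 2 = 1 := by
      rw [← inner_self_eq_norm_sq (𝕜 := ℂ), h, RCLike.one_re]
    exact (pow_eq_one_iff_of_nonneg (norm_nonneg _) two_ne_zero).1 h2
  cyclic := by
    have : (fun x => τ.gnsStarAlgHom x (gnsVector τ)) =
        (fun v : τ.PreGNS => (v : τ.GNS)) ∘ τ.toPreGNS := funext gnsStarAlgHom_apply_gnsVector
    rw [this]
    exact UniformSpace.Completion.denseRange_coe.comp τ.toPreGNS.surjective.denseRange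
      (UniformSpace.Completion.continuous_coe _)
  trace x y := by rw [inner_gnsVector, inner_gnsVector, hτ.trace]

end Gns

end TracialFermi

end

open TracialFermi in
theorem theorem4 {H 𝒜 : Type*} [NormedAddCommGroup H] [InnerProductSpace ℂ H] [CompleteSpace H]
    (conj : H ≃ₗᵢ⋆[ℂ] H) (hconj : ∀ f, conj (conj f) = f)
    [CStarAlgebra 𝒜] [PartialOrder 𝒜] [StarOrderedRing 𝒜]
    (a : H →ₗ⋆[ℂ] 𝒜) (ha : IsCARAlgebra a)
    (τ : 𝒜 →ₚ[ℂ] ℂ) (hτ : IsTracialState τ) :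
    ∃ (A B b : H →ₗ⋆[ℂ] (τ.GNS →L[ℂ] τ.GNS)) (J : τ.GNS ≃ₗᵢ⋆[ℂ] τ.GNS)
      (W : τ.GNS →L[ℂ] τ.GNS),
      -- the GNS representation is the vacuum representation of the doubled algebra
      IsVacuumRepresentation A B (gnsVector τ) ∧
      (∀ x, ⟪gnsVector τ, τ.gnsStarAlgHom x (gnsVector τ)⟫_ℂ = τ x) ∧
      (∀ (F : Type*) [NormedAddCommGroup F] [InnerProductSpace ℂ F] [CompleteSpace F]
        (A' B' : H →ₗ⋆[ℂ] (F →L[ℂ] F)) (Ω' : F), IsVacuumRepresentation A' B' Ω' →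
        ∃ U : τ.GNS ≃ₗᵢ[ℂ] F, U (gnsVector τ) = Ω' ∧
          (∀ f ψ, U (A f ψ) = A' f (U ψ)) ∧ (∀ f ψ, U (B f ψ) = B' f (U ψ))) ∧
      -- `J` is the modular conjugation and `W` is the parity operator
      IsModularConjugation (Set.centralizer (Set.centralizer (Set.range τ.gnsStarAlgHom)))
        (gnsVector τ) J ∧
      (∀ ψ ∈ evenSubspace (generators A ∪ generators B) (gnsVector τ), W ψ = ψ) ∧
      (∀ ψ ∈ oddSubspace (generators A ∪ generators B) (gnsVector τ), W ψ = -ψ) ∧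
      -- the Bogoliubov transformation
      (∀ f, gnsField τ a f = ((1 / √2 : ℝ) : ℂ) • (A f + star (B (conj f)))) ∧
      (∀ f, b f = ((1 / √2 : ℝ) : ℂ) • (A f - star (B (conj f)))) ∧
      (∀ f ψ, b f ψ = W (J (star (gnsField τ a f) (J ψ)))) ∧
      (∀ f ψ, W (J (gnsField τ a (conj f) (J ψ))) = -(star (b (conj f)) ψ)) ∧
      -- the relations between the `a` and the `b`
      IsDoubleCAR (gnsField τ a) b ∧
      (∀ x ∈ (evenPolynomials (generators b)).topologicalClosure, ∀ y : 𝒜,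
        Commute x (τ.gnsStarAlgHom y)) ∧
      -- the commutant
      (∀ f, ∀ y : 𝒜, Commute (W * b f) (τ.gnsStarAlgHom y) ∧
        Commute (star (b f) * W) (τ.gnsStarAlgHom y)) ∧
      Set.centralizer (Set.centralizer
          (Set.range (fun f => W * b f) ∪ Set.range (fun g => star (b g) * W))) =
        Set.centralizer (Set.range τ.gnsStarAlgHom) := by
  have h := hτ.isTracialVector
  obtain ⟨J, hJ⟩ := h.exists_conjugation
  obtain ⟨W, hW⟩ := ha.exists_parityOperator h
  let b := twistedField τ.gnsStarAlgHom a J W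
  let A := bogoliubovLeft (gnsField τ a) b
  let B := bogoliubovRight conj (gnsField τ a) b
  have hvac : IsVacuumRepresentation A B (gnsVector τ) :=
    isVacuumRepresentation_bogoliubov conj hconj ha h hJ hW
  have hWx : ∀ x ∈ generators A ∪ generators B, W * x = -(x * W) := fun x =>
    anticommute_bogoliubov fun y => hW.anticommute_fields ha h hJ
  refine ⟨A, B, b, J, W, hvac, inner_gnsVector, ?_, hJ.isModularConjugation h,
    fun ψ => apply_of_mem_evenSubspace hW.apply_vector hWx,
    fun ψ => apply_of_mem_oddSubspace hW.apply_vector hWx, bogoliubov_add hconj,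
    bogoliubov_sub hconj, fun f ψ => rfl, fun f ψ => ?_, isDoubleCAR_twistedField ha h hJ hW,
    fun x => commute_of_mem_evenPolynomials ha h hJ hW, fun f y => ⟨?_, ?_⟩,
    centralizer_twistedField ha h hJ hW⟩
  · intro F _ _ _ A' B' Ω' h'
    exact hvac.exists_unitary h'
  · rw [star_twistedField h hJ hW]
    exact DFunLike.congr_fun (hW.mul_conjugate hJ ha h (mem_generators_left a (conj f))) ψ
  · rw [parity_mul_twistedField ha h hW]
    exact hJ.commute h _ _
  · rw [star_twistedField_mul_parity ha h hJ hW]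
    exact hJ.commute h _ _
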